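/- Let $X_1, X_2, \dots$ be i.i.d. integrable real random variables with $E[X_1] > 0$ and $P(X_1 < 0) > 0$, and suppose that $\alpha > 0$ (the adjustment coefficient) satisfies $E[e^{-\alpha X_1}] = 1$. Let $S_0 = 0$ and $S_n = \sum_{i=1}^n X_i$. For $d > 0$ let $$\tau_d = \min\{n \ge 0 : \max_{0 \le k \le n} S_k \ge S_n + d\}$$ be the first time at which the random walk has a drawdown of size at least $d$, and let $M_d = \max_{0 \le k \le \tau_d} S_k$ be the maximal height reached by then. Then $\tau_d < \infty$ almost surely, $M_d$ is integrable, and $$E[M_d] \ge \frac{e^{\alpha d} - 1}{\alpha}.$$ -/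

import Mathlib

open MeasureTheory ProbabilityTheory

namespace RandomWalkDrawdown

/-- The random walk with increments `X 0, X 1, …`: `S 0 = 0` and `S n = X 0 + ⋯ + X (n - 1)`. -/
def walk {Ω : Type*} (X : ℕ → Ω → ℝ) (n : ℕ) (ω : Ω) : ℝ :=
  ∑ i ∈ Finset.range n, X i ω

/-- The running maximum `max (S 0, …, S n)` of a discrete-time process `S`. -/
noncomputable def runningMax {Ω : Type*} (S : ℕ → Ω → ℝ) (n : ℕ) (ω : Ω) : ℝ :=
  (Finset.range (n + 1)).sup' Finset.nonempty_range_add_one (fun k => S k ω)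

/-- The first time at which the process `S` has a drawdown of size at least `d`, that is,
`min {n | max (S 0, …, S n) ≥ S n + d}`; it is `⊤` if there is no such time. -/
noncomputable def drawdownTime {Ω : Type*} (S : ℕ → Ω → ℝ) (d : ℝ) : Ω → WithTop ℕ :=
  hittingAfter (fun n ω => runningMax S n ω - S n ω) (Set.Ici d) 0

/-- The maximal height reached by `S` up to its first drawdown of size at least `d`: the running
maximum at the time `drawdownTime S d` (an arbitrary value where that time is `⊤`). -/
noncomputable def maxHeight {Ω : Type*} (S : ℕ → Ω → ℝ) (d : ℝ) : Ω → ℝ :=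
  stoppedValue (runningMax S) (drawdownTime S d)

end RandomWalkDrawdown

namespace RandomWalkDrawdown

variable {Ω : Type*}

/-! Write `Y` for the drawdown and `M` for the running maximum. `Y` is the walk `-S` reflected at 0,
and `M` grows by `max 0 (X n - Y n)`. Since `E[exp (-α X)] = 1`, `exp (α Y)` has mean-zero
increments except at reflection, where `1 ≤ exp (-α u) + α u` charges the excess to the growth `u`
of `M` (`indicator_alive_mul_sub_le`). Stopping at `τ` gives `exp (α d) ≤ 1 + α E[M_τ]`, as `Y_τ ≥
d`.

For finiteness of `τ` and integrability, a second exponential `exp (θ Y)`, with `θ` large, grows in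
mean by at least `P(τ > i)` at step `i`. Capping it makes these tails summable
(`summable_measureReal_alive`), and a Wald-type bound of `M_τ` by the sum of the `|X i|` with `i <
τ` gives integrability. -/

/-- The drawdown of the random walk with increments `X` from its running maximum. -/
noncomputable def drawdown (X : ℕ → Ω → ℝ) (n : ℕ) (ω : Ω) : ℝ :=
  runningMax (walk X) n ω - walk X n ω

/-- The event that no drawdown of size at least `d` has occurred up to time `n`. -/
def alive (X : ℕ → Ω → ℝ) (d : ℝ) (n : ℕ) : Set Ω := {ω | ∀ k ≤ n, drawdown X k ω < d}

/-- The σ-algebra generated by the increments before time `n`. -/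
abbrev past (X : ℕ → Ω → ℝ) (n : ℕ) : MeasurableSpace Ω :=
  ⨆ j ∈ Set.Iio n, MeasurableSpace.comap (X j) inferInstance

/-- The increments of `U` summed as long as no drawdown of size at least `d` has occurred. -/
noncomputable def stoppedSum (X : ℕ → Ω → ℝ) (d : ℝ) (U : ℕ → Ω → ℝ) (n : ℕ) (ω : Ω) : ℝ :=
  ∑ i ∈ Finset.range n, (alive X d i).indicator 1 ω * (U (i + 1) ω - U i ω)

/-! ### Pathwise recursions and stopped sums -/

lemma walk_succ (X : ℕ → Ω → ℝ) (n : ℕ) (ω : Ω) : walk X (n + 1) ω = walk X n ω + X n ω :=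
  Finset.sum_range_succ _ _

lemma runningMax_succ (S : ℕ → Ω → ℝ) (n : ℕ) (ω : Ω) :
    runningMax S (n + 1) ω = max (runningMax S n ω) (S (n + 1) ω) := by
  apply le_antisymm
  · refine Finset.sup'_le _ _ fun k hk => ?_
    rcases Nat.lt_succ_iff_lt_or_eq.mp (Finset.mem_range.mp hk) with h | rfl
    · exact le_max_of_le_left
        (Finset.le_sup' (fun k => S k ω) (Finset.mem_range.mpr h))
    · exact le_max_right _ _
  · refine max_le (Finset.sup'_mono _ (Finset.range_mono (by omega)) _) ?_
    exact Finset.le_sup' (fun k => S k ω) (Finset.self_mem_range_succ _)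

lemma runningMax_walk_zero (X : ℕ → Ω → ℝ) (ω : Ω) : runningMax (walk X) 0 ω = 0 := by
  simp [runningMax, walk]

lemma drawdown_zero (X : ℕ → Ω → ℝ) (ω : Ω) : drawdown X 0 ω = 0 := by
  simp [drawdown, runningMax_walk_zero, walk]

lemma drawdown_nonneg (X : ℕ → Ω → ℝ) (n : ℕ) (ω : Ω) : 0 ≤ drawdown X n ω :=
  sub_nonneg.mpr (Finset.le_sup' (fun k => walk X k ω) (Finset.self_mem_range_succ n))

lemma drawdown_succ (X : ℕ → Ω → ℝ) (n : ℕ) (ω : Ω) :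
    drawdown X (n + 1) ω = max (drawdown X n ω - X n ω) 0 := by
  unfold drawdown
  rw [runningMax_succ, walk_succ, ← max_sub_sub_right]
  congr 1 <;> ring

lemma runningMax_walk_succ (X : ℕ → Ω → ℝ) (n : ℕ) (ω : Ω) :
    runningMax (walk X) (n + 1) ω - runningMax (walk X) n ω
      = max 0 (X n ω - drawdown X n ω) := by
  rw [runningMax_succ, walk_succ, ← max_sub_sub_right, drawdown]
  congr 1 <;> ring

lemma runningMax_walk_succ_sub_le (X : ℕ → Ω → ℝ) (n : ℕ) (ω : Ω) :
    runningMax (walk X) (n + 1) ω - runningMax (walk X) n ω ≤ |X n ω| := by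
  rw [runningMax_walk_succ]
  exact max_le (abs_nonneg _) (by linarith [le_abs_self (X n ω), drawdown_nonneg X n ω])

lemma mem_alive_iff (X : ℕ → Ω → ℝ) (d : ℝ) (n : ℕ) (ω : Ω) :
    ω ∈ alive X d n ↔ WithTop.some n < drawdownTime (walk X) d ω := by
  rw [← not_iff_not, not_lt, drawdownTime, hittingAfter_le_iff]
  simp [alive, drawdown]

/-- The sum telescopes: `stoppedSum X d U n` is `U` at `min n τ` minus `U 0`, written as a sum so
that expectations can be taken term by term. -/
lemma stoppedSum_of_le {X : ℕ → Ω → ℝ} {d : ℝ} (U : ℕ → Ω → ℝ) {n : ℕ} {ω : Ω}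
    (h : WithTop.some n ≤ drawdownTime (walk X) d ω) :
    stoppedSum X d U n ω = U n ω - U 0 ω := by
  rw [← Finset.sum_range_sub (fun i => U i ω)]
  refine Finset.sum_congr rfl fun i hi => ?_
  rw [Set.indicator_of_mem, Pi.one_apply, one_mul]
  rw [mem_alive_iff]
  exact lt_of_lt_of_le (WithTop.coe_lt_coe.mpr (Finset.mem_range.mp hi)) h

lemma stoppedSum_of_ge {X : ℕ → Ω → ℝ} {d : ℝ} (U : ℕ → Ω → ℝ) {n t : ℕ} {ω : Ω}
    (ht : drawdownTime (walk X) d ω = WithTop.some t) (h : t ≤ n) :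
    stoppedSum X d U n ω = U t ω - U 0 ω := by
  rw [← stoppedSum_of_le U ht.ge, stoppedSum, stoppedSum]
  symm
  refine Finset.sum_subset (Finset.range_mono h) fun i _ hi => ?_
  rw [Set.indicator_of_notMem, zero_mul]
  rw [mem_alive_iff, ht, WithTop.coe_lt_coe]
  simpa using hi

/-- Transfers uniform bounds on `U` to its stopped sums. -/
lemma exists_stoppedSum_eq (X : ℕ → Ω → ℝ) (d : ℝ) (U : ℕ → Ω → ℝ) (n : ℕ) (ω : Ω) :
    ∃ m, stoppedSum X d U n ω = U m ω - U 0 ω := by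
  rcases le_total (WithTop.some n) (drawdownTime (walk X) d ω) with h | h
  · exact ⟨n, stoppedSum_of_le U h⟩
  · obtain ⟨t, ht⟩ := WithTop.ne_top_iff_exists.mp (h.trans_lt (WithTop.coe_lt_top n)).ne
    exact ⟨t, stoppedSum_of_ge U ht.symm (WithTop.coe_le_coe.mp (ht.trans_le h))⟩

lemma le_drawdown_of_drawdownTime_eq {X : ℕ → Ω → ℝ} {d : ℝ} {t : ℕ} {ω : Ω}
    (ht : drawdownTime (walk X) d ω = WithTop.some t) : d ≤ drawdown X t ω := by
  have h : drawdownTime (walk X) d ω ≠ ⊤ := by simp [ht]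
  have := hittingAfter_mem_set_of_ne_top h
  rw [← drawdownTime, ht] at this
  exact this

lemma indicator_alive_nonneg (X : ℕ → Ω → ℝ) (d : ℝ) (n : ℕ) (ω : Ω) :
    0 ≤ (alive X d n).indicator (1 : Ω → ℝ) ω :=
  Set.indicator_nonneg (fun _ _ => zero_le_one) _

lemma indicator_alive_le_one (X : ℕ → Ω → ℝ) (d : ℝ) (n : ℕ) (ω : Ω) :
    (alive X d n).indicator (1 : Ω → ℝ) ω ≤ 1 :=
  Set.indicator_le_self' (fun _ _ => zero_le_one) _

/-- A jump below `-ε` raises the drawdown by at least `ε`, and from below `d` the level `drawdown +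
ε` stays under the cap `d + ε`. Other jumps are bounded below by 0. -/
lemma indicator_alive_mul_exp_le (X : ℕ → Ω → ℝ) {θ : ℝ} (hθ : 0 < θ) (ε d : ℝ) (n : ℕ) (ω : Ω) :
    (alive X d n).indicator 1 ω * Real.exp (θ * drawdown X n ω) *
        (Real.exp (θ * ε) * (Set.Iio (-ε)).indicator 1 (X n ω))
      - (alive X d n).indicator 1 ω * Real.exp (θ * drawdown X n ω)
    ≤ (alive X d n).indicator 1 ω *
      (min (Real.exp (θ * drawdown X (n + 1) ω)) (Real.exp (θ * (d + ε)))
        - min (Real.exp (θ * drawdown X n ω)) (Real.exp (θ * (d + ε)))) := by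
  by_cases hω : ω ∈ alive X d n
  · have hY := hω n le_rfl
    simp only [Set.indicator_of_mem hω, Pi.one_apply, one_mul]
    refine sub_le_sub ?_ (min_le_left _ _)
    by_cases hx : X n ω < -ε
    · rw [Set.indicator_of_mem (by exact hx), Pi.one_apply, mul_one, ← Real.exp_add, ← mul_add]
      have : drawdown X n ω + ε ≤ drawdown X (n + 1) ω := by
        rw [drawdown_succ]
        exact le_max_of_le_left (by linarith)
      refine le_min ?_ ?_ <;> gcongr
    · rw [Set.indicator_of_notMem (by exact hx), mul_zero, mul_zero]
      positivity
  · simp [hω]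

lemma stoppedSum_runningMax_of_ge {X : ℕ → Ω → ℝ} {d : ℝ} {n t : ℕ} {ω : Ω}
    (ht : drawdownTime (walk X) d ω = WithTop.some t) (h : t ≤ n) :
    stoppedSum X d (runningMax (walk X)) n ω = maxHeight (walk X) d ω := by
  rw [stoppedSum_of_ge _ ht h, runningMax_walk_zero, sub_zero, maxHeight, stoppedValue, ht]
  rfl

lemma stoppedSum_runningMax_mono (X : ℕ → Ω → ℝ) (d : ℝ) (ω : Ω) :
    Monotone fun n => stoppedSum X d (runningMax (walk X)) n ω := by
  refine monotone_nat_of_le_succ fun n => ?_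
  rw [stoppedSum, stoppedSum, Finset.sum_range_succ, runningMax_walk_succ]
  exact le_add_of_nonneg_right (mul_nonneg (indicator_alive_nonneg X d n ω) (le_max_left _ _))

lemma indicator_alive_mul_sub_le (X : ℕ → Ω → ℝ) {α : ℝ} (hα : 0 < α) (d : ℝ) (n : ℕ) (ω : Ω) :
    (alive X d n).indicator 1 ω *
      (min (Real.exp (α * drawdown X (n + 1) ω)) (Real.exp (α * d))
        - min (Real.exp (α * drawdown X n ω)) (Real.exp (α * d)))
    ≤ ((alive X d n).indicator 1 ω * Real.exp (α * drawdown X n ω) * Real.exp (-α * X n ω)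
        - (alive X d n).indicator 1 ω * Real.exp (α * drawdown X n ω))
      + α * ((alive X d n).indicator 1 ω *
        (runningMax (walk X) (n + 1) ω - runningMax (walk X) n ω)) := by
  by_cases hω : ω ∈ alive X d n
  · have hY := hω n le_rfl
    simp only [Set.indicator_of_mem hω, Pi.one_apply, one_mul]
    rw [min_eq_left (b := Real.exp (α * d)) (a := Real.exp (α * drawdown X n ω)) (by gcongr),
      ← Real.exp_add, runningMax_walk_succ, drawdown_succ]
    suffices h : Real.exp (α * max (drawdown X n ω - X n ω) 0)
        ≤ Real.exp (α * drawdown X n ω + -α * X n ω) + α * max 0 (X n ω - drawdown X n ω) by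
      linarith [min_le_left (Real.exp (α * max (drawdown X n ω - X n ω) 0)) (Real.exp (α * d))]
    have he : α * drawdown X n ω + -α * X n ω = α * (drawdown X n ω - X n ω) := by ring
    rw [he]
    rcases le_total (X n ω) (drawdown X n ω) with h | h
    · rw [max_eq_left (by linarith), max_eq_left (by linarith)]
      simp
    · rw [max_eq_right (by linarith), max_eq_right (by linarith), mul_zero, Real.exp_zero]
      linarith [Real.add_one_le_exp (α * (drawdown X n ω - X n ω))]
  · simp [hω]

/-- The hitting time depends only on the path at `ω`, so it can be computed on a one-point space. -/
lemma drawdownTime_congr {S T : ℕ → Ω → ℝ} {ω : Ω} (h : ∀ n, S n ω = T n ω) (d : ℝ) :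
    drawdownTime S d ω = drawdownTime T d ω :=
  congrArg (fun s : ℕ → ℝ => drawdownTime (fun n (_ : Unit) => s n) d ()) (funext h)

lemma maxHeight_congr {S T : ℕ → Ω → ℝ} {ω : Ω} (h : ∀ n, S n ω = T n ω) (d : ℝ) :
    maxHeight S d ω = maxHeight T d ω := by
  simp only [maxHeight, stoppedValue, drawdownTime_congr h, runningMax, h]

section Probability

/-! ### Predictability, independence and integrability -/

lemma past_mono (X : ℕ → Ω → ℝ) : Monotone (past X) :=
  fun _ _ h => biSup_mono fun _ hj => lt_of_lt_of_le hj h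

lemma past_le [MeasurableSpace Ω] {X : ℕ → Ω → ℝ} (hX : ∀ i, Measurable (X i)) (n : ℕ) :
    past X n ≤ ‹MeasurableSpace Ω› :=
  iSup₂_le fun j _ => (hX j).comap_le

lemma measurable_increment_past (X : ℕ → Ω → ℝ) {j n : ℕ} (h : j < n) :
    Measurable[past X n] (X j) := by
  rw [measurable_iff_comap_le]
  exact le_iSup₂ (f := fun j (_ : j ∈ Set.Iio n) =>
    MeasurableSpace.comap (X j) (inferInstance : MeasurableSpace ℝ)) j h

/-- The drawdown at time `n` involves only `X j` with `j < n`, hence is independent of `X n`, the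
increment of the next step. -/
lemma measurable_drawdown_past (X : ℕ → Ω → ℝ) (n : ℕ) :
    Measurable[past X n] (drawdown X n) := by
  induction n with
  | zero =>
    rw [show drawdown X 0 = fun _ => 0 from funext (drawdown_zero X)]
    exact measurable_const
  | succ n ih =>
    rw [show drawdown X (n + 1) = fun ω => max (drawdown X n ω - X n ω) 0 from
      funext (drawdown_succ X n)]
    exact ((ih.mono (past_mono X n.le_succ) le_rfl).sub
      (measurable_increment_past X n.lt_succ_self)).max measurable_const

lemma measurableSet_alive_past (X : ℕ → Ω → ℝ) (d : ℝ) (n : ℕ) :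
    MeasurableSet[past X n] (alive X d n) := by
  have : alive X d n = ⋂ k ∈ Set.Iic n, {ω | drawdown X k ω < d} := by
    ext; simp [alive]
  rw [this]
  exact MeasurableSet.biInter (Set.to_countable _) fun k hk =>
    ((measurable_drawdown_past X k).mono (past_mono X hk) le_rfl) measurableSet_Iio

lemma measurable_indicator_alive_past (X : ℕ → Ω → ℝ) (d : ℝ) (n : ℕ) :
    Measurable[past X n] ((alive X d n).indicator (1 : Ω → ℝ)) := by
  have key : ∀ {m : MeasurableSpace Ω} {A : Set Ω}, MeasurableSet[m] A →
      Measurable[m] (A.indicator (1 : Ω → ℝ)) := fun h => measurable_one.indicator h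
  exact key (measurableSet_alive_past X d n)

lemma measurable_indicator_alive_mul_exp_past (X : ℕ → Ω → ℝ) (d θ : ℝ) (n : ℕ) :
    Measurable[past X n]
      (fun ω => (alive X d n).indicator 1 ω * Real.exp (θ * drawdown X n ω)) :=
  (measurable_indicator_alive_past X d n).mul ((measurable_drawdown_past X n).const_mul θ).exp

variable [MeasurableSpace Ω] {P : Measure Ω} {X : ℕ → Ω → ℝ}

lemma indepFun_of_measurable_past (hX : ∀ i, Measurable (X i)) (hindep : iIndepFun X P)
    {n : ℕ} {f : Ω → ℝ} (hf : Measurable[past X n] f) : IndepFun f (X n) P := by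
  have h := indep_iSup_of_disjoint (fun j => (hX j).comap_le)
    ((iIndepFun_iff_iIndep _ _ _).mp hindep)
    (S := Set.Iio n) (T := {n}) (by simp)
  rw [iSup_singleton] at h
  rw [IndepFun_iff_Indep]
  exact indep_of_indep_of_le_left h hf.comap_le

lemma integrable_mul_increment (hX : ∀ i, Measurable (X i)) (hindep : iIndepFun X P)
    (hident : ∀ i, IdentDistrib (X i) (X 0) P P) {n : ℕ} {f : Ω → ℝ}
    (hf : Measurable[past X n] f) (hfi : Integrable f P) {φ : ℝ → ℝ} (hφ : Measurable φ)
    (hφi : Integrable (fun ω => φ (X 0 ω)) P) :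
    Integrable (fun ω => f ω * φ (X n ω)) P ∧
      ∫ ω, f ω * φ (X n ω) ∂P = (∫ ω, f ω ∂P) * ∫ ω, φ (X 0 ω) ∂P := by
  have hI : IndepFun f (fun ω => φ (X n ω)) P :=
    (indepFun_of_measurable_past hX hindep hf).comp measurable_id hφ
  have hid := (hident n).comp hφ
  have hn : Integrable (fun ω => φ (X n ω)) P := hid.integrable_iff.mpr hφi
  refine ⟨hI.integrable_mul hfi hn, ?_⟩
  rw [hI.integral_fun_mul_eq_mul_integral hfi.1 hn.1]
  exact congrArg _ hid.integral_eq

lemma measurable_drawdown (hX : ∀ i, Measurable (X i)) (n : ℕ) : Measurable (drawdown X n) :=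
  (measurable_drawdown_past X n).mono (past_le hX n) le_rfl

lemma measurableSet_alive (hX : ∀ i, Measurable (X i)) (d : ℝ) (n : ℕ) :
    MeasurableSet (alive X d n) :=
  past_le hX n _ (measurableSet_alive_past X d n)

lemma measurable_walk (hX : ∀ i, Measurable (X i)) (n : ℕ) : Measurable (walk X n) := by
  unfold walk
  exact Finset.measurable_sum _ fun i _ => hX i

lemma measurable_runningMax (hX : ∀ i, Measurable (X i)) (n : ℕ) :
    Measurable (runningMax (walk X) n) := by
  have : runningMax (walk X) n = fun ω => drawdown X n ω + walk X n ω := by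
    ext; simp [drawdown]
  rw [this]
  exact (measurable_drawdown hX n).add (measurable_walk hX n)

lemma measurable_indicator_alive (hX : ∀ i, Measurable (X i)) (d : ℝ) (n : ℕ) :
    Measurable ((alive X d n).indicator (1 : Ω → ℝ)) :=
  measurable_one.indicator (measurableSet_alive hX d n)

lemma integrable_stoppedSum_runningMax_term (hX : ∀ i, Measurable (X i))
    (hXi : ∀ i, Integrable (X i) P) (d : ℝ) (n : ℕ) :
    Integrable (fun ω => (alive X d n).indicator 1 ω *
      (runningMax (walk X) (n + 1) ω - runningMax (walk X) n ω)) P := by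
  refine (hXi n).mono ((measurable_indicator_alive hX d n).mul
    ((measurable_runningMax hX (n + 1)).sub (measurable_runningMax hX n))).aestronglyMeasurable
    (ae_of_all _ fun ω => ?_)
  have h0 : 0 ≤ runningMax (walk X) (n + 1) ω - runningMax (walk X) n ω := by
    rw [runningMax_walk_succ]
    exact le_max_left _ _
  rw [Real.norm_of_nonneg (mul_nonneg (indicator_alive_nonneg X d n ω) h0)]
  exact (mul_le_of_le_one_left h0 (indicator_alive_le_one X d n ω)).trans
    (runningMax_walk_succ_sub_le X n ω)

lemma exists_measure_lt_neg_pos {Z : Ω → ℝ} (h : 0 < P {ω | Z ω < 0}) :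
    ∃ ε > 0, 0 < P {ω | Z ω < -ε} := by
  have hU : {ω | Z ω < 0} = ⋃ n : ℕ, {ω | Z ω < -(1 / ((n : ℝ) + 1))} := by
    ext ω
    simp only [Set.mem_ofPred_eq, Set.mem_iUnion]
    constructor
    · intro hω
      obtain ⟨n, hn⟩ := exists_nat_one_div_lt (neg_pos.mpr hω)
      exact ⟨n, by linarith⟩
    · rintro ⟨n, hn⟩
      have : 0 < 1 / ((n : ℝ) + 1) := by positivity
      linarith
  rw [hU] at h
  obtain ⟨n, hn⟩ := exists_measure_pos_of_not_measure_iUnion_null h.ne'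
  exact ⟨1 / ((n : ℝ) + 1), by positivity, hn⟩

variable [IsProbabilityMeasure P]

lemma integrable_indicator_alive (hX : ∀ i, Measurable (X i)) (d : ℝ) (n : ℕ) :
    Integrable ((alive X d n).indicator (1 : Ω → ℝ)) P :=
  (integrable_const (1 : ℝ)).indicator (measurableSet_alive hX d n)

lemma integrable_indicator_alive_mul_exp (hX : ∀ i, Measurable (X i)) {d θ : ℝ} (hθ : 0 ≤ θ)
    (n : ℕ) :
    Integrable (fun ω => (alive X d n).indicator 1 ω * Real.exp (θ * drawdown X n ω)) P := by
  refine Integrable.of_bound ((measurable_indicator_alive hX d n).mul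
    ((measurable_drawdown hX n).const_mul θ).exp).aestronglyMeasurable (Real.exp (θ * d))
    (ae_of_all _ fun ω => ?_)
  by_cases h : ω ∈ alive X d n
  · have := (h n le_rfl).le
    simp only [Set.indicator_of_mem h, Pi.one_apply, one_mul, Real.norm_eq_abs, Real.abs_exp]
    gcongr
  · simp [h, Real.exp_nonneg]

lemma integrable_stoppedSum_term_of_bounded (hX : ∀ i, Measurable (X i)) (d : ℝ) {g : ℝ → ℝ}
    (hg : Measurable g) {K : ℝ} (hK : ∀ y, |g y| ≤ K) (n : ℕ) :
    Integrable (fun ω => (alive X d n).indicator 1 ω *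
      (g (drawdown X (n + 1) ω) - g (drawdown X n ω))) P := by
  have h : ∀ m, Integrable (fun ω => g (drawdown X m ω)) P := fun m =>
    Integrable.of_bound (hg.comp (measurable_drawdown hX m)).aestronglyMeasurable K
      (ae_of_all _ fun ω => hK _)
  refine ((h (n + 1)).sub (h n)).bdd_mul
    (measurable_indicator_alive hX d n).aestronglyMeasurable (c := 1)
    (ae_of_all _ fun ω => ?_)
  rw [Real.norm_of_nonneg (indicator_alive_nonneg X d n ω)]
  exact indicator_alive_le_one X d n ω

lemma integrable_stoppedSum_of_bounded (hX : ∀ i, Measurable (X i)) (d : ℝ) {g : ℝ → ℝ}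
    (hg : Measurable g) {K : ℝ} (hK : ∀ y, |g y| ≤ K) (n : ℕ) :
    Integrable (stoppedSum X d (fun i ω => g (drawdown X i ω)) n) P :=
  integrable_finsetSum _ fun i _ => integrable_stoppedSum_term_of_bounded hX d hg hK i

/-! ### Finiteness of the drawdown time and integrability of the height -/

/-- The tail probabilities of the time of the first large drawdown are summable. -/
theorem summable_measureReal_alive (hX : ∀ i, Measurable (X i)) (hindep : iIndepFun X P)
    (hident : ∀ i, IdentDistrib (X i) (X 0) P P) (hneg : 0 < P {ω | X 0 ω < 0}) (d : ℝ) :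
    Summable fun i => P.real (alive X d i) := by
  obtain ⟨ε, hε, hpos⟩ := exists_measure_lt_neg_pos hneg
  set δ := P.real {ω | X 0 ω < -ε} with hδdef
  have hδ : 0 < δ := ENNReal.toReal_pos hpos.ne' (measure_ne_top _ _)
  have hδ1 : δ ≤ 1 := measureReal_le_one
  have hlog : 0 < Real.log (2 / δ) := Real.log_pos (by rw [lt_div_iff₀ hδ]; linarith)
  -- Chosen so that `exp (θ * ε) * δ = 2`: jumps below `-ε` alone double the exponential in mean, a
  -- gain of at least its value, which is at least 1.
  set θ := Real.log (2 / δ) / ε with hθdef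
  have hθ : 0 < θ := div_pos hlog hε
  have hθε : Real.exp (θ * ε) = 2 / δ := by
    rw [hθdef, div_mul_cancel₀ _ hε.ne', Real.exp_log (by positivity)]
  set g : ℝ → ℝ := fun y => min (Real.exp (θ * y)) (Real.exp (θ * (d + ε))) with hgdef
  have hg : Measurable g := by fun_prop
  have hg0 : ∀ y, 0 ≤ g y := fun y => by positivity
  have hgK : ∀ y, |g y| ≤ Real.exp (θ * (d + ε)) := fun y => by
    rw [abs_of_nonneg (hg0 y)]
    exact min_le_right _ _
  set φ : ℝ → ℝ := fun x => Real.exp (θ * ε) * (Set.Iio (-ε)).indicator 1 x with hφdef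
  have hφ : Measurable φ := (measurable_one.indicator measurableSet_Iio).const_mul _
  have hset : MeasurableSet {ω | X 0 ω < -ε} := hX 0 measurableSet_Iio
  have hφ0 : (fun ω => φ (X 0 ω))
      = fun ω => Real.exp (θ * ε) * {ω | X 0 ω < -ε}.indicator 1 ω := rfl
  have hφi : Integrable (fun ω => φ (X 0 ω)) P := by
    rw [hφ0]
    exact ((integrable_const (1 : ℝ)).indicator hset).const_mul _
  have hφ2 : ∫ ω, φ (X 0 ω) ∂P = 2 := by
    rw [hφ0, integral_const_mul, integral_indicator_one hset, hθε, ← hδdef]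
    field_simp
  have hstep : ∀ i, P.real (alive X d i) ≤ ∫ ω, (alive X d i).indicator 1 ω *
      (g (drawdown X (i + 1) ω) - g (drawdown X i ω)) ∂P := fun i => by
    have hfi := integrable_indicator_alive_mul_exp (P := P) hX (d := d) hθ.le i
    obtain ⟨h1, h2⟩ := integrable_mul_increment hX hindep hident
      (measurable_indicator_alive_mul_exp_past X d θ i) hfi hφ hφi
    calc P.real (alive X d i) = ∫ ω, (alive X d i).indicator 1 ω ∂P :=
          (integral_indicator_one (measurableSet_alive hX d i)).symm
      _ ≤ ∫ ω, (alive X d i).indicator 1 ω * Real.exp (θ * drawdown X i ω) ∂P := by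
          refine integral_mono (integrable_indicator_alive hX d i) hfi fun ω => ?_
          exact le_mul_of_one_le_right (indicator_alive_nonneg X d i ω)
            (Real.one_le_exp (mul_nonneg hθ.le (drawdown_nonneg X i ω)))
      _ = ∫ ω, ((alive X d i).indicator 1 ω * Real.exp (θ * drawdown X i ω) * φ (X i ω)
            - (alive X d i).indicator 1 ω * Real.exp (θ * drawdown X i ω)) ∂P := by
          rw [integral_sub h1 hfi, h2, hφ2]
          ring
      _ ≤ _ := integral_mono (h1.sub hfi)
          (integrable_stoppedSum_term_of_bounded hX d hg hgK i)
          fun ω => indicator_alive_mul_exp_le X hθ ε d i ω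
  refine summable_of_sum_range_le (c := Real.exp (θ * (d + ε)))
    (fun _ => measureReal_nonneg) fun n => ?_
  calc ∑ i ∈ Finset.range n, P.real (alive X d i)
      ≤ ∑ i ∈ Finset.range n, ∫ ω, (alive X d i).indicator 1 ω *
          (g (drawdown X (i + 1) ω) - g (drawdown X i ω)) ∂P :=
        Finset.sum_le_sum fun i _ => hstep i
    _ = ∫ ω, stoppedSum X d (fun i ω => g (drawdown X i ω)) n ω ∂P :=
        (integral_finsetSum _ fun i _ =>
          integrable_stoppedSum_term_of_bounded hX d hg hgK i).symm
    _ ≤ ∫ _, Real.exp (θ * (d + ε)) ∂P := by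
        refine integral_mono (integrable_stoppedSum_of_bounded hX d hg hgK n)
          (integrable_const _) fun ω => ?_
        obtain ⟨m, hm⟩ := exists_stoppedSum_eq X d (fun i ω => g (drawdown X i ω)) n ω
        simp only [hm]
        linarith [hg0 (drawdown X 0 ω), (abs_le.mp (hgK (drawdown X m ω))).2]
    _ = Real.exp (θ * (d + ε)) := by simp

/-- A random walk whose increments are negative with positive probability almost surely has
a drawdown of size at least `d`. -/
theorem ae_drawdownTime_lt_top (hX : ∀ i, Measurable (X i)) (hindep : iIndepFun X P)
    (hident : ∀ i, IdentDistrib (X i) (X 0) P P) (hneg : 0 < P {ω | X 0 ω < 0}) (d : ℝ) :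
    ∀ᵐ ω ∂P, drawdownTime (walk X) d ω < ⊤ := by
  have hlim := (summable_measureReal_alive hX hindep hident hneg d).tendsto_atTop_zero
  have h0 : P.real {ω | ¬ drawdownTime (walk X) d ω < ⊤} ≤ 0 :=
    ge_of_tendsto' hlim fun n => measureReal_mono fun ω hω => by
      rw [mem_alive_iff, not_lt_top_iff.mp hω]
      exact WithTop.coe_lt_top n
  rw [ae_iff]
  exact (measureReal_eq_zero_iff).mp (le_antisymm h0 measureReal_nonneg)

/-- The height reached up to the first large drawdown is integrable. -/
theorem integrable_maxHeight (hX : ∀ i, Measurable (X i)) (hindep : iIndepFun X P)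
    (hident : ∀ i, IdentDistrib (X i) (X 0) P P) (hint : Integrable (X 0) P)
    (hneg : 0 < P {ω | X 0 ω < 0}) (d : ℝ) :
    Integrable (maxHeight (walk X) d) P := by
  have hXi : ∀ i, Integrable (X i) P := fun i => (hident i).integrable_iff.mpr hint
  have htop := ae_drawdownTime_lt_top hX hindep hident hneg d
  constructor
  -- Almost surely the stopped sums are eventually constant, equal to the height.
  · refine aestronglyMeasurable_of_tendsto_ae Filter.atTop
      (f := stoppedSum X d (runningMax (walk X)))
      (fun n => (integrable_finsetSum _ fun i _ =>
        integrable_stoppedSum_runningMax_term hX hXi d i).1) ?_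
    filter_upwards [htop] with ω hω
    obtain ⟨t, ht⟩ := WithTop.ne_top_iff_exists.mp hω.ne
    refine tendsto_const_nhds.congr' ?_
    filter_upwards [Filter.eventually_ge_atTop t] with n hn
    exact (stoppedSum_runningMax_of_ge ht.symm hn).symm
  · have hterm : ∀ i, ∫⁻ ω, ENNReal.ofReal ((alive X d i).indicator 1 ω * |X i ω|) ∂P
        = ENNReal.ofReal (P.real (alive X d i) * ∫ ω, |X 0 ω| ∂P) := fun i => by
      obtain ⟨h1, h2⟩ := integrable_mul_increment hX hindep hident
        (measurable_indicator_alive_past X d i) (integrable_indicator_alive hX d i)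
        (φ := fun x => |x|) measurable_norm hint.abs
      rw [← ofReal_integral_eq_lintegral_ofReal h1 (ae_of_all _ fun ω =>
        mul_nonneg (indicator_alive_nonneg X d i ω) (abs_nonneg _)), h2,
        integral_indicator_one (measurableSet_alive hX d i)]
    calc ∫⁻ ω, ‖maxHeight (walk X) d ω‖ₑ ∂P
        ≤ ∫⁻ ω, ∑' i, ENNReal.ofReal ((alive X d i).indicator 1 ω * |X i ω|) ∂P := by
          refine lintegral_mono_ae ?_
          filter_upwards [htop] with ω hω
          obtain ⟨t, ht⟩ := WithTop.ne_top_iff_exists.mp hω.ne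
          have hs := stoppedSum_runningMax_of_ge ht.symm le_rfl
          have h0 : 0 ≤ maxHeight (walk X) d ω := by
            rw [← hs]
            exact (stoppedSum_runningMax_mono X d ω (Nat.zero_le t)).trans' (by simp [stoppedSum])
          rw [Real.enorm_of_nonneg h0]
          refine le_trans ?_ (ENNReal.sum_le_tsum (Finset.range t))
          rw [← ENNReal.ofReal_sum_of_nonneg fun i _ =>
            mul_nonneg (indicator_alive_nonneg X d i ω) (abs_nonneg _), ← hs]
          refine ENNReal.ofReal_le_ofReal (Finset.sum_le_sum fun i _ => ?_)
          exact mul_le_mul_of_nonneg_left (runningMax_walk_succ_sub_le X i ω)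
            (indicator_alive_nonneg X d i ω)
      _ = ∑' i, ENNReal.ofReal (P.real (alive X d i) * ∫ ω, |X 0 ω| ∂P) := by
          rw [lintegral_tsum fun i => (show Measurable fun ω => ENNReal.ofReal
            ((alive X d i).indicator 1 ω * |X i ω|) from
            ((measurable_indicator_alive hX d i).mul (hX i).abs).ennreal_ofReal).aemeasurable]
          exact tsum_congr hterm
      _ < ⊤ := ((summable_measureReal_alive hX hindep hident hneg d).mul_right
          _).tsum_ofReal_lt_top

/-! ### The lower bound -/

/-- Optional stopping for the supermartingale `exp (α * drawdown) - α * runningMax`, at the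
minimum of `n` and the time of the first large drawdown. -/
lemma exp_mul_le_integral_maxHeight (hX : ∀ i, Measurable (X i)) (hindep : iIndepFun X P)
    (hident : ∀ i, IdentDistrib (X i) (X 0) P P) (hint : Integrable (X 0) P)
    (hneg : 0 < P {ω | X 0 ω < 0}) {α : ℝ} (hα : 0 < α)
    (hαint : Integrable (fun ω => Real.exp (-α * X 0 ω)) P)
    (hαX : ∫ ω, Real.exp (-α * X 0 ω) ∂P = 1) {d : ℝ} (hd : 0 < d) (n : ℕ) :
    Real.exp (α * d) * (1 - P.real (alive X d n))
      ≤ 1 + α * ∫ ω, maxHeight (walk X) d ω ∂P := by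
  have hXi : ∀ i, Integrable (X i) P := fun i => (hident i).integrable_iff.mpr hint
  -- The cap leaves values before `τ` unchanged and removes the overshoot at `τ`, so `h` is bounded
  -- and equals `exp (α * d)` there.
  set h : ℝ → ℝ := fun y => min (Real.exp (α * y)) (Real.exp (α * d)) with hhdef
  have hh : Measurable h := by fun_prop
  have hh0 : ∀ y, 0 ≤ h y := fun y => by positivity
  have hhK : ∀ y, |h y| ≤ Real.exp (α * d) := fun y => by
    rw [abs_of_nonneg (hh0 y)]
    exact min_le_right _ _
  have hM := fun i => integrable_stoppedSum_runningMax_term (P := P) hX hXi d i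
  have hMsum : Integrable (stoppedSum X d (runningMax (walk X)) n) P :=
    integrable_finsetSum _ fun i _ => hM i
  have hstep : ∀ i, ∫ ω, (alive X d i).indicator 1 ω *
        (h (drawdown X (i + 1) ω) - h (drawdown X i ω)) ∂P
      ≤ α * ∫ ω, (alive X d i).indicator 1 ω *
        (runningMax (walk X) (i + 1) ω - runningMax (walk X) i ω) ∂P := fun i => by
    have hfi := integrable_indicator_alive_mul_exp (P := P) hX (d := d) hα.le i
    obtain ⟨h1, h2⟩ := integrable_mul_increment hX hindep hident
      (measurable_indicator_alive_mul_exp_past X d α i) hfi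
      (φ := fun x => Real.exp (-α * x)) (by fun_prop) hαint
    refine (integral_mono (integrable_stoppedSum_term_of_bounded hX d hh hhK i)
      ((h1.sub hfi).add ((hM i).const_mul α))
      fun ω => indicator_alive_mul_sub_le X hα d i ω).trans_eq ?_
    -- The exponential part integrates to 0 by independence and `hαX`.
    rw [integral_add' (h1.sub hfi) ((hM i).const_mul α), integral_const_mul,
      integral_sub' h1 hfi, h2, hαX]
    ring
  have hcompl := measureReal_compl (μ := P) (measurableSet_alive hX d n)
  rw [probReal_univ] at hcompl
  calc Real.exp (α * d) * (1 - P.real (alive X d n))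
      = ∫ ω, Real.exp (α * d) * (alive X d n)ᶜ.indicator 1 ω ∂P := by
        rw [integral_const_mul, integral_indicator_one (measurableSet_alive hX d n).compl, hcompl]
    _ ≤ ∫ ω, (1 + stoppedSum X d (fun i ω => h (drawdown X i ω)) n ω) ∂P := by
        refine integral_mono (((integrable_const (1 : ℝ)).indicator
          (measurableSet_alive hX d n).compl).const_mul _)
          ((integrable_const _).add (integrable_stoppedSum_of_bounded hX d hh hhK n)) fun ω => ?_
        have hz : h (drawdown X 0 ω) = 1 := by
          simp [hhdef, drawdown_zero, (mul_pos hα hd).le]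
        by_cases hω : ω ∈ alive X d n
        · obtain ⟨m, hm⟩ := exists_stoppedSum_eq X d (fun i ω => h (drawdown X i ω)) n ω
          simp only [hm, hz, Set.indicator_of_notMem (Set.notMem_compl_iff.mpr hω)]
          linarith [hh0 (drawdown X m ω)]
        · have hle := hω
          rw [mem_alive_iff, not_lt] at hle
          obtain ⟨t, ht⟩ :=
            WithTop.ne_top_iff_exists.mp (hle.trans_lt (WithTop.coe_lt_top n)).ne
          simp only [stoppedSum_of_ge _ ht.symm (WithTop.coe_le_coe.mp (ht.trans_le hle)), hz,
            Set.indicator_of_mem (Set.mem_compl hω), Pi.one_apply, mul_one]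
          have hdt := le_drawdown_of_drawdownTime_eq ht.symm
          have : h (drawdown X t ω) = Real.exp (α * d) := min_eq_right (by gcongr)
          linarith
    _ = 1 + ∑ i ∈ Finset.range n, ∫ ω, (alive X d i).indicator 1 ω *
          (h (drawdown X (i + 1) ω) - h (drawdown X i ω)) ∂P := by
        rw [integral_add (integrable_const _) (integrable_stoppedSum_of_bounded hX d hh hhK n)]
        simp only [stoppedSum]
        rw [integral_finsetSum _ fun i _ =>
          integrable_stoppedSum_term_of_bounded hX d hh hhK i]
        simp
    _ ≤ 1 + ∑ i ∈ Finset.range n, α * ∫ ω, (alive X d i).indicator 1 ω *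
          (runningMax (walk X) (i + 1) ω - runningMax (walk X) i ω) ∂P := by
        gcongr with i
        exact hstep i
    _ = 1 + α * ∫ ω, stoppedSum X d (runningMax (walk X)) n ω ∂P := by
        rw [← Finset.mul_sum, ← integral_finsetSum _ fun i _ => hM i]
        rfl
    _ ≤ 1 + α * ∫ ω, maxHeight (walk X) d ω ∂P := by
        gcongr 1 + α * ?_
        refine integral_mono_ae hMsum (integrable_maxHeight hX hindep hident hint hneg d) ?_
        filter_upwards [ae_drawdownTime_lt_top hX hindep hident hneg d] with ω hω
        obtain ⟨t, ht⟩ := WithTop.ne_top_iff_exists.mp hω.ne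
        -- The height is the stopped sum at any time past `t`; `max n t` is also past `n`, so
        -- monotonicity applies.
        rw [← stoppedSum_runningMax_of_ge ht.symm (le_max_right n t)]
        exact stoppedSum_runningMax_mono X d ω (le_max_left n t)

/-- The lower bound for the expected height at the first large drawdown. -/
theorem le_integral_maxHeight (hX : ∀ i, Measurable (X i)) (hindep : iIndepFun X P)
    (hident : ∀ i, IdentDistrib (X i) (X 0) P P) (hint : Integrable (X 0) P)
    (hneg : 0 < P {ω | X 0 ω < 0}) {α : ℝ} (hα : 0 < α)
    (hαint : Integrable (fun ω => Real.exp (-α * X 0 ω)) P)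
    (hαX : ∫ ω, Real.exp (-α * X 0 ω) ∂P = 1) {d : ℝ} (hd : 0 < d) :
    (Real.exp (α * d) - 1) / α ≤ ∫ ω, maxHeight (walk X) d ω ∂P := by
  have hlim := (((summable_measureReal_alive hX hindep hident hneg d).tendsto_atTop_zero).const_sub
    1).const_mul (Real.exp (α * d))
  have := le_of_tendsto' hlim fun n =>
    exp_mul_le_integral_maxHeight hX hindep hident hint hneg hα hαint hαX hd n
  rw [div_le_iff₀ hα]
  linarith

end Probability

end RandomWalkDrawdown

theorem mainTheorem1 {Ω : Type*} [MeasurableSpace Ω] (P : Measure Ω) [IsProbabilityMeasure P]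
    (X : ℕ → Ω → ℝ)
    (hindep : iIndepFun X P)
    (hident : ∀ i, IdentDistrib (X i) (X 0) P P)
    (hint : Integrable (X 0) P)
    (hmean : 0 < ∫ ω, X 0 ω ∂P)
    (hneg : 0 < P {ω | X 0 ω < 0})
    (α : ℝ) (hα : 0 < α)
    (hαint : Integrable (fun ω => Real.exp (-α * X 0 ω)) P)
    (hαX : ∫ ω, Real.exp (-α * X 0 ω) ∂P = 1)
    (d : ℝ) (hd : 0 < d) :
    (∀ᵐ ω ∂P, RandomWalkDrawdown.drawdownTime (RandomWalkDrawdown.walk X) d ω < ⊤) ∧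
    Integrable (RandomWalkDrawdown.maxHeight (RandomWalkDrawdown.walk X) d) P ∧
    (Real.exp (α * d) - 1) / α
      ≤ ∫ ω, RandomWalkDrawdown.maxHeight (RandomWalkDrawdown.walk X) d ω ∂P := by
  have hXm : ∀ i, AEMeasurable (X i) P := fun i => (hident i).aemeasurable_fst
  -- `IdentDistrib` gives only a.e. measurability; measurable versions agree almost surely with `X`
  -- at all times at once.
  let Z : ℕ → Ω → ℝ := fun i => (hXm i).mk (X i)
  have hZ : ∀ i, Measurable (Z i) := fun i => (hXm i).measurable_mk
  have hXZ : ∀ i, X i =ᵐ[P] Z i := fun i => (hXm i).ae_eq_mk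
  have hZX : ∀ i, IdentDistrib (Z i) (X i) P P := fun i =>
    (IdentDistrib.of_ae_eq (hXm i) (hXZ i)).symm
  have hZindep : iIndepFun Z P := hindep.congr hXZ
  have hZident : ∀ i, IdentDistrib (Z i) (Z 0) P P := fun i =>
    ((hZX i).trans (hident i)).trans (hZX 0).symm
  have hZint : Integrable (Z 0) P := (hZX 0).integrable_iff.mpr hint
  have hZneg : 0 < P {ω | Z 0 ω < 0} := by
    have := (hZX 0).measure_mem_eq (measurableSet_Iio (a := (0 : ℝ)))
    exact hneg.trans_eq this.symm
  have hZexp := (hZX 0).comp (u := fun x => Real.exp (-α * x)) (by fun_prop)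
  have hwalk : ∀ᵐ ω ∂P, ∀ n, RandomWalkDrawdown.walk Z n ω = RandomWalkDrawdown.walk X n ω := by
    filter_upwards [ae_all_iff.mpr hXZ] with ω hω n
    simp only [RandomWalkDrawdown.walk, hω]
  have hmax : RandomWalkDrawdown.maxHeight (RandomWalkDrawdown.walk Z) d
      =ᵐ[P] RandomWalkDrawdown.maxHeight (RandomWalkDrawdown.walk X) d := by
    filter_upwards [hwalk] with ω hω
    exact RandomWalkDrawdown.maxHeight_congr hω d
  refine ⟨?_, ?_, ?_⟩
  · filter_upwards [hwalk, RandomWalkDrawdown.ae_drawdownTime_lt_top hZ hZindep hZident hZneg d]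
      with ω hω h
    rwa [← RandomWalkDrawdown.drawdownTime_congr hω]
  · exact (RandomWalkDrawdown.integrable_maxHeight hZ hZindep hZident hZint hZneg d).congr hmax
  · rw [← integral_congr_ae hmax]
    exact RandomWalkDrawdown.le_integral_maxHeight hZ hZindep hZident hZint hZneg hα
      (hZexp.integrable_iff.mpr hαint) (hZexp.integral_eq.trans hαX) hd
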